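/- All rings are commutative with $1$. Let $A$ be a ring, $V$ an $A$-algebra, $S = V[x_1,\dots,x_n]$ and $\mathfrak a_S \subseteq S$ an ideal. Assume that for every prime ideal $\mathfrak p \supseteq \mathfrak a_S$ of $S$ the following hold: (1) $S_{\mathfrak p}$ is a regular local ring; (2) the surjection $S_{\mathfrak p}/\mathfrak p^2 S_{\mathfrak p} \to S_{\mathfrak p}/\mathfrak p S_{\mathfrak p}$ splits as a map of $A$-algebras, i.e. it has a section that is a homomorphism of $A$-algebras. Let $I \subseteq S$ be an ideal, $R = S/I$, $\mathfrak a$ the image of $\mathfrak a_S$ in $R$, $\overline S = S/\mathfrak a_S$ and $\overline R = R/\mathfrak a$. Let $\Omega_{S/A}$ be the module of Kähler differentials with universal derivation $d_{S/A}$, let $\overline\Omega_{S/A} = \overline S \otimes_S \Omega_{S/A}$, and let $\overline d_{S/A} : S \to \overline\Omega_{S/A}$, $f \mapsto 1 \otimes d_{S/A}(f)$. Let $$\mathcal J : \frac{I}{I^2 + \mathfrak a_S I} \longrightarrow \overline R \otimes_{\overline S} \overline\Omega_{S/A}, \qquad \mathcal J([f]) = 1 \otimes \overline d_{S/A}(f),$$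 which is a well-defined $\overline R$-linear map. Let $\mathfrak q$ be a prime ideal of $S$ with $\mathfrak q \supseteq I + \mathfrak a_S$, and let $k(\mathfrak q) = S_{\mathfrak q}/\mathfrak q S_{\mathfrak q}$, which is an $\overline R$-algebra. Then $R_{\mathfrak q}$ is a regular local ring if and only if $$\operatorname{rank}_{k(\mathfrak q)}\bigl(\mathcal J \otimes_{\overline R} k(\mathfrak q)\bigr) = \operatorname{height} I S_{\mathfrak q}.$$ -/

import Mathlib

open scoped TensorProduct

namespace MixedJacobian

universe u v

section Setup

variable (A : Type u) [CommRing A] {S : Type v} [CommRing S] [Algebra A S]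

/-- The surjection `S_q / q² S_q → S_q / q S_q` of `A`-algebras. -/
noncomputable def residueProj (q : Ideal S) [q.IsPrime] :
    (Localization.AtPrime q ⧸ (q ^ 2).map (algebraMap S (Localization.AtPrime q))) →ₐ[A]
      (Localization.AtPrime q ⧸ q.map (algebraMap S (Localization.AtPrime q))) :=
  Ideal.Quotient.factorₐ A (Ideal.map_mono (Ideal.pow_le_self two_ne_zero))

/-- `S_q / q² S_q → S_q / q S_q` has a section that is a map of `A`-algebras. -/
def ResidueSplits (q : Ideal S) [q.IsPrime] : Prop :=
  ∃ s : (Localization.AtPrime q ⧸ q.map (algebraMap S (Localization.AtPrime q))) →ₐ[A]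
      (Localization.AtPrime q ⧸ (q ^ 2).map (algebraMap S (Localization.AtPrime q))),
    (residueProj A q).comp s = AlgHom.id A _

/-- For every prime `q` containing `aS`, the ring `S_q` is a regular local ring and
`S_q / q² S_q → S_q / q S_q` splits as a map of `A`-algebras. -/
def IsSetup (aS : Ideal S) : Prop :=
  ∀ (q : Ideal S) [q.IsPrime], aS ≤ q →
    IsRegularLocalRing (Localization.AtPrime q) ∧ ResidueSplits A q

end Setup

section Jacobian

variable {S : Type v} [CommRing S] (I aS : Ideal S)

/-- `S̄ = S / aS`. -/
def SBar : Type v := S ⧸ aS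

noncomputable instance : CommRing (SBar aS) := inferInstanceAs (CommRing (S ⧸ aS))

/-- The quotient map `S → S̄`. -/
noncomputable def mkSBar : S →+* SBar aS := Ideal.Quotient.mk aS

noncomputable instance {A : Type u} [CommRing A] [Algebra A S] : Algebra A (SBar aS) :=
  ((mkSBar aS).comp (algebraMap A S)).toAlgebra

instance {A : Type u} [CommRing A] [Algebra A S] : IsScalarTower A S (SBar aS) :=
  IsScalarTower.of_algebraMap_eq fun _ => rfl

/-- `R̄ = R / 𝔞`, where `R = S / I` and `𝔞` is the image of `aS` in `R`. -/
def RBar : Type v := (S ⧸ I) ⧸ aS.map (Ideal.Quotient.mk I)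

noncomputable instance : CommRing (RBar I aS) :=
  inferInstanceAs (CommRing ((S ⧸ I) ⧸ aS.map (Ideal.Quotient.mk I)))

/-- The composite `S → R → R̄` of the quotient maps. -/
noncomputable def mkRBar : S →+* RBar I aS :=
  (Ideal.Quotient.mk (aS.map (Ideal.Quotient.mk I))).comp (Ideal.Quotient.mk I)

noncomputable instance : Algebra S (RBar I aS) := (mkRBar I aS).toAlgebra

theorem mkRBar_surjective : Function.Surjective (mkRBar I aS) :=
  Ideal.Quotient.mk_surjective.comp Ideal.Quotient.mk_surjective

theorem mkRBar_eq_zero (s : S) (hs : s ∈ I ⊔ aS) : mkRBar I aS s = 0 := by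
  change Ideal.Quotient.mk _ (Ideal.Quotient.mk I s) = 0
  rw [Ideal.Quotient.eq_zero_iff_mem]
  obtain ⟨a, ha, b, hb, rfl⟩ := Submodule.mem_sup.1 hs
  rw [map_add, Ideal.Quotient.eq_zero_iff_mem.2 ha, zero_add]
  exact Ideal.mem_map_of_mem _ hb

/-- The map on `R̄` induced by a ring homomorphism on `S` that kills `I + aS`. -/
noncomputable def liftRBar {T : Type*} [Ring T] (f : S →+* T) (hf : ∀ s ∈ I ⊔ aS, f s = 0) :
    RBar I aS →+* T :=
  Ideal.Quotient.lift (aS.map (Ideal.Quotient.mk I))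
    (Ideal.Quotient.lift I f fun s hs => hf s (Ideal.mem_sup_left hs)) (by
      intro r hr
      obtain ⟨s, hs, rfl⟩ :=
        (Ideal.mem_map_iff_of_surjective _ Ideal.Quotient.mk_surjective).1 hr
      exact hf s (Ideal.mem_sup_right hs))

theorem liftRBar_mk {T : Type*} [Ring T] (f : S →+* T) (hf : ∀ s ∈ I ⊔ aS, f s = 0) (s : S) :
    liftRBar I aS f hf (mkRBar I aS s) = f s := rfl

/-- The map `S̄ → R̄` induced by `S → R`. -/
noncomputable def sBarToRBar : SBar aS →+* RBar I aS :=
  Ideal.Quotient.lift aS (mkRBar I aS) fun s hs => mkRBar_eq_zero I aS s (Ideal.mem_sup_right hs)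

noncomputable instance : Algebra (SBar aS) (RBar I aS) := (sBarToRBar I aS).toAlgebra

instance : IsScalarTower S (SBar aS) (RBar I aS) := IsScalarTower.of_algebraMap_eq fun _ => rfl

/-- `I² + aS I`, as a submodule of `I`. -/
abbrev conormalRel : Submodule S I := Submodule.comap (Submodule.subtype I) (I ^ 2 ⊔ aS * I)

/-- The module `I / (I² + aS I)`. -/
abbrev ConormalBar : Type v := I ⧸ conormalRel I aS

theorem conormalBar_torsion (s : S) (hs : s ∈ I ⊔ aS) (x : ConormalBar I aS) : s • x = 0 := by
  obtain ⟨f, rfl⟩ := Submodule.Quotient.mk_surjective _ x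
  rw [← Submodule.Quotient.mk_smul, Submodule.Quotient.mk_eq_zero]
  obtain ⟨a, ha, b, hb, rfl⟩ := Submodule.mem_sup.1 hs
  change (a + b) * (f : S) ∈ I ^ 2 ⊔ aS * I
  rw [add_mul]
  refine Submodule.add_mem_sup ?_ (Ideal.mul_mem_mul hb f.2)
  rw [sq]
  exact Ideal.mul_mem_mul ha f.2

/-- The structure map of `I / (I² + aS I)` as an `R̄`-module: the class of `s : S` acts as `s`. -/
noncomputable def conormalAction : RBar I aS →+* AddMonoid.End (ConormalBar I aS) :=
  liftRBar I aS (Module.toAddMonoidEnd S (ConormalBar I aS)) fun s hs =>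
    AddMonoidHom.ext fun x => conormalBar_torsion I aS s hs x

noncomputable instance : Module (RBar I aS) (ConormalBar I aS) :=
  Module.compHom _ (conormalAction I aS)

theorem algebraMap_smul_conormalBar (s : S) (x : ConormalBar I aS) :
    algebraMap S (RBar I aS) s • x = s • x := rfl

instance : IsScalarTower S (RBar I aS) (ConormalBar I aS) :=
  IsScalarTower.of_algebraMap_smul (algebraMap_smul_conormalBar I aS)

variable (A : Type u) [CommRing A] [Algebra A S]

/-- `Ω̄_{S/A} = S̄ ⊗ Ω_{S/A}`, where `S̄ = S / aS`. -/
abbrev OmegaBar : Type v := SBar aS ⊗[S] Ω[S⁄A]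

/-- `d̄ : S → Ω̄_{S/A}`, the universal `A`-derivation followed by `Ω_{S/A} → Ω̄_{S/A}`. -/
noncomputable def dBar : Derivation A S (OmegaBar aS A) :=
  (TensorProduct.mk S (SBar aS) Ω[S⁄A] 1).compDer (KaehlerDifferential.D A S)

/-- The `R̄`-module `R̄ ⊗_{S̄} Ω̄_{S/A}`. -/
abbrev JacobianTarget : Type v := RBar I aS ⊗[SBar aS] OmegaBar aS A

theorem jacobianTarget_torsion (s : S) (hs : s ∈ I ⊔ aS) (m : JacobianTarget I aS A) :
    s • m = 0 := by
  rw [← algebraMap_smul (RBar I aS) s m,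
    show algebraMap S (RBar I aS) s = 0 from mkRBar_eq_zero I aS s hs, zero_smul]

/-- The map `I → R̄ ⊗ Ω̄_{S/A}`, `f ↦ 1 ⊗ d̄ f`; it is `S`-linear since `I` kills the target. -/
noncomputable def jacobianAux : I →ₗ[S] JacobianTarget I aS A where
  toFun f := 1 ⊗ₜ dBar aS A (f : S)
  map_add' f g := by simp [TensorProduct.tmul_add]
  map_smul' s f := by
    simp only [SetLike.val_smul, smul_eq_mul, Derivation.leibniz, TensorProduct.tmul_add,
      TensorProduct.tmul_smul, jacobianTarget_torsion I aS A _ (Ideal.mem_sup_left f.2), add_zero,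
      RingHom.id_apply]

theorem jacobianAux_apply (f : I) : jacobianAux I aS A f = 1 ⊗ₜ dBar aS A (f : S) := rfl

theorem conormalRel_le_ker : conormalRel I aS ≤ LinearMap.ker (jacobianAux I aS A) := by
  have hle : I ^ 2 ⊔ aS * I ≤ (I ⊔ aS) * I := by
    rw [sq, ← Ideal.sup_mul]
  rintro ⟨f, hf⟩ hfr
  have hf' : f ∈ (I ⊔ aS) * I := hle hfr
  have main : ∀ g ∈ (I ⊔ aS) * I, ∃ hg : g ∈ I, jacobianAux I aS A ⟨g, hg⟩ = 0 := by
    intro g hg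
    induction hg using Submodule.mul_induction_on' with
    | mem_mul_mem a ha b hb =>
      refine ⟨I.mul_mem_left a hb, ?_⟩
      have : (⟨a * b, I.mul_mem_left a hb⟩ : I) = a • ⟨b, hb⟩ := rfl
      rw [this, map_smul, jacobianTarget_torsion I aS A a ha]
    | add x _ y _ hx hy =>
      obtain ⟨hx, hx'⟩ := hx
      obtain ⟨hy, hy'⟩ := hy
      refine ⟨I.add_mem hx hy, ?_⟩
      have : (⟨x + y, I.add_mem hx hy⟩ : I) = ⟨x, hx⟩ + ⟨y, hy⟩ := rfl
      rw [this, map_add, hx', hy', add_zero]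
  exact (main f hf').2

/-- The `R̄`-linear map `𝒥 : I / (I² + aS I) → R̄ ⊗_{S̄} Ω̄_{S/A}`, `[f] ↦ 1 ⊗ d̄ f`. -/
noncomputable def jacobianMap : ConormalBar I aS →ₗ[RBar I aS] JacobianTarget I aS A :=
  ((conormalRel I aS).liftQ (jacobianAux I aS A)
    (conormalRel_le_ker I aS A)).extendScalarsOfSurjective (mkRBar_surjective I aS)

theorem jacobianMap_mk (f : I) :
    jacobianMap I aS A (Submodule.Quotient.mk f) = 1 ⊗ₜ dBar aS A (f : S) := rfl

variable {I aS}

/-- For a prime `q ⊇ I + aS`, the map `R̄ → k(q)` induced by `S → k(q)`. -/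
noncomputable def toResidueField (q : Ideal S) [q.IsPrime] (h : I ⊔ aS ≤ q) :
    RBar I aS →+* q.ResidueField :=
  liftRBar I aS (algebraMap S q.ResidueField) fun _ hs =>
    Ideal.algebraMap_residueField_eq_zero.2 (h hs)

/-- The rank of the `k(q)`-linear map `𝒥 ⊗_{R̄} k(q)`, for a prime `q ⊇ I + aS`. -/
noncomputable def jacobianRank (q : Ideal S) [q.IsPrime] (h : I ⊔ aS ≤ q) : Cardinal.{v} :=
  letI : Algebra (RBar I aS) q.ResidueField := (toResidueField q h).toAlgebra
  LinearMap.rank ((jacobianMap I aS A).baseChange q.ResidueField)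

end Jacobian

end MixedJacobian

/-! Write B = S_q, with maximal ideal m and residue field k, and J = I B, so that R_q = B/J. The
proof measures J by its image in m/m² (`cotangentSpan`). The splitting makes m/m² → k ⊗ Ω_{B/A}
injective: if g is a section of B/m² → k, then b ↦ b − g(b̄) is an A-derivation B → m/m² extending
the quotient map on m. This map carries the image of J onto the range of 𝒥 ⊗ k, both being spanned
by differentials of elements of I. So the Jacobian rank is the dimension r of the image of J
(`jacobianRank_eq`). It remains to see that B/J is regular iff r = height J
(`quotient_iff_finrank_cotangentSpan_eq_height`). Lift a basis of the image of J to elements of J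
and let P be the ideal they generate. Then B/P is regular, hence a domain, and P is a prime of
height r inside J. Each side of the equivalence forces J = P: equality of the dimensions of B/J and
B/P in one direction, equality of heights of primes in the other. -/

namespace IsLocalRing

/-! ### The image of an ideal in the cotangent space -/

variable {B : Type*} [CommRing B] [IsLocalRing B]

/-- The span of the image of an ideal in the cotangent space of a local ring. -/
noncomputable def cotangentSpan (J : Ideal B) : Submodule (ResidueField B) (CotangentSpace B) :=
  Submodule.span _ ((maximalIdeal B).toCotangent '' {x | (x : B) ∈ J})

/-- B acts on m/m² through its residue field, so the image of J ∩ m is already a k-subspace. -/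
theorem restrictScalars_cotangentSpan (J : Ideal B) :
    (cotangentSpan J).restrictScalars B =
      (Submodule.comap (maximalIdeal B).subtype J).map (maximalIdeal B).toCotangent := by
  rw [cotangentSpan, Submodule.restrictScalars_span _ _ Ideal.Quotient.mk_surjective,
    ← Submodule.map_span]
  congr 1
  exact Submodule.span_eq (Submodule.comap (maximalIdeal B).subtype J)

/-- The kernel of the surjection from the cotangent space of B to that of B/J is the image of J. -/
theorem finrank_cotangentSpace_quotient_add [IsNoetherianRing B] {J : Ideal B}
    [IsLocalRing (B ⧸ J)] :
    Module.finrank (ResidueField (B ⧸ J)) (CotangentSpace (B ⧸ J)) +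
      Module.finrank (ResidueField B) (cotangentSpan J) =
        Module.finrank (ResidueField B) (CotangentSpace B) := by
  have hJ : J ≤ maximalIdeal B :=
    le_maximalIdeal (Ideal.Quotient.nontrivial_iff.1 inferInstance)
  have surj : Function.Surjective (algebraMap B (B ⧸ J)) := Ideal.Quotient.mk_surjective
  have : IsLocalHom (algebraMap B (B ⧸ J)) := surj.isLocalHom
  have hker : RingHom.ker (algebraMap B (B ⧸ J)) = J := Ideal.mk_ker
  have eq : (maximalIdeal (B ⧸ J)).comap (algebraMap B (B ⧸ J)) =
      RingHom.ker (algebraMap B (B ⧸ J)) ⊔ maximalIdeal B := by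
    rw [hker, sup_eq_right.2 hJ, maximalIdeal_comap]
  have h1 := Ideal.mapCotangent_surjective_of_comap_eq surj eq
  have h2 := Ideal.mapCotangent_ker_of_surjective surj eq
  have h3 : Submodule.comap (maximalIdeal B).subtype
      (RingHom.ker (algebraMap B (B ⧸ J)) ⊓ maximalIdeal B) =
        Submodule.comap (maximalIdeal B).subtype J := by
    rw [hker, inf_eq_left.2 hJ]
  rw [h3, ← restrictScalars_cotangentSpan] at h2
  rw [← Submodule.finrank_quotient_add_finrank (cotangentSpan J)]
  congr 1
  let e : (CotangentSpace B ⧸ cotangentSpan J) ≃ₗ[B] CotangentSpace (B ⧸ J) :=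
    (Submodule.Quotient.restrictScalarsEquiv B (cotangentSpan J)).symm.trans
      ((Submodule.quotEquivOfEq _ _ h2.symm).trans (LinearMap.quotKerEquivOfSurjective _ h1))
  -- The two spaces live over different residue fields; `e` is semilinear along the isomorphism
  -- between them.
  refine (congrArg Cardinal.toNat (rank_eq_of_equiv_equiv
    (ResidueField.map (algebraMap B (B ⧸ J))) e.toAddEquiv ?_ ?_)).symm
  · refine ⟨RingHom.injective _, fun y => ?_⟩
    obtain ⟨y, rfl⟩ := residue_surjective y
    obtain ⟨y, rfl⟩ := surj y
    exact ⟨residue B y, rfl⟩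
  · intro r m
    obtain ⟨r, rfl⟩ := residue_surjective r
    have := e.map_smul r m
    rw [← algebraMap_smul (ResidueField B) r m] at this
    refine this.trans ?_
    rw [← algebraMap_smul (B ⧸ J),
      ← algebraMap_smul (ResidueField (B ⧸ J)) (algebraMap B (B ⧸ J) r)]
    rfl

end IsLocalRing

/-! ### Ideals generated by elements of the maximal ideal -/

namespace IsLocalRing

section

variable {B : Type*} [CommRing B] [IsLocalRing B]

theorem cotangentSpan_span (s : Set (maximalIdeal B)) :
    cotangentSpan (Ideal.span ((↑) '' s : Set B)) =
      Submodule.span (ResidueField B) ((maximalIdeal B).toCotangent '' s) := by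
  apply Submodule.restrictScalars_injective B
  rw [restrictScalars_cotangentSpan,
    Submodule.restrictScalars_span _ _ Ideal.Quotient.mk_surjective, ← Submodule.map_span]
  congr 1
  have h : Ideal.span ((↑) '' s : Set B) = (Submodule.span B s).map (maximalIdeal B).subtype :=
    Submodule.span_image (maximalIdeal B).subtype
  rw [h, Submodule.comap_map_eq_of_injective (maximalIdeal B).injective_subtype]

theorem finrank_cotangentSpan_span_range {n : ℕ} {v : Fin n → maximalIdeal B}
    (hv : LinearIndependent (ResidueField B) ((maximalIdeal B).toCotangent ∘ v)) :
    Module.finrank (ResidueField B)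
      (cotangentSpan (Ideal.span ((↑) '' Set.range v : Set B))) = n := by
  rw [cotangentSpan_span, ← Set.range_comp, finrank_span_eq_card hv, Fintype.card_fin]

theorem spanFinrank_span_range_le {n : ℕ} (v : Fin n → maximalIdeal B) :
    (Ideal.span ((↑) '' Set.range v : Set B)).spanFinrank ≤ n := by
  refine (Submodule.spanFinrank_span_le_ncard_of_finite (Set.toFinite _)).trans ?_
  rw [← Set.range_comp, ← Nat.card_coe_set_eq]
  exact (Finite.card_range_le _).trans_eq (Nat.card_fin n)

theorem exists_span_range_eq_cotangentSpan [IsNoetherianRing B] (J : Ideal B) :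
    ∃ v : Fin (Module.finrank (ResidueField B) (cotangentSpan J)) → maximalIdeal B,
      (∀ i, (v i : B) ∈ J) ∧
      LinearIndependent (ResidueField B) ((maximalIdeal B).toCotangent ∘ v) ∧
      cotangentSpan (Ideal.span ((↑) '' Set.range v : Set B)) = cotangentSpan J := by
  obtain ⟨w, hw, hws, hwl⟩ := Submodule.exists_fun_fin_finrank_span_eq (ResidueField B)
    ((maximalIdeal B).toCotangent '' {x | (x : B) ∈ J})
  choose v hvJ hvw using hw
  obtain rfl : (maximalIdeal B).toCotangent ∘ v = w := funext hvw
  refine ⟨v, hvJ, hwl, ?_⟩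
  exact (cotangentSpan_span _).trans
    ((congrArg (Submodule.span _) (Set.range_comp _ _).symm).trans hws)

theorem isLocalRing_quotient {J : Ideal B} (hJ : J ≠ ⊤) : IsLocalRing (B ⧸ J) :=
  have := Ideal.Quotient.nontrivial_iff.2 hJ
  .of_surjective' (Ideal.Quotient.mk J) Ideal.Quotient.mk_surjective

theorem ne_top_of_le_maximalIdeal {J : Ideal B} (hJ : J ≤ maximalIdeal B) : J ≠ ⊤ :=
  fun h => Ideal.IsPrime.ne_top' (top_le_iff.1 (h ▸ hJ))

theorem span_image_le_maximalIdeal (s : Set (maximalIdeal B)) :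
    Ideal.span ((↑) '' s : Set B) ≤ maximalIdeal B := by
  rw [Ideal.span_le]
  rintro _ ⟨x, -, rfl⟩
  exact x.2

end

end IsLocalRing

/-! ### Regular quotients, and regular local rings as domains -/

namespace IsRegularLocalRing

open IsLocalRing

section

variable {B : Type*} [CommRing B] [IsRegularLocalRing B]

/-- Passing to B/P lowers the embedding dimension by the dimension of the image of P, and the Krull
dimension by at most the number of generators of P. -/
theorem quotient_of_spanFinrank_le {P : Ideal B} (hP : P ≤ maximalIdeal B)
    (h : P.spanFinrank ≤ Module.finrank (ResidueField B) (cotangentSpan P)) :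
    IsRegularLocalRing (B ⧸ P) := by
  have := isLocalRing_quotient (ne_top_of_le_maximalIdeal hP)
  apply of_spanFinrank_maximalIdeal_le
  rw [spanFinrank_maximalIdeal_eq_finrank_cotangentSpace]
  have h1 := finrank_cotangentSpace_quotient_add (J := P)
  have h2 := ringKrullDim_le_ringKrullDim_quotient_add_spanFinrank P
    (hP.trans (IsLocalRing.ringJacobson_eq_maximalIdeal B).ge)
  have h3 := (iff_finrank_cotangentSpace B).1 inferInstance
  rw [← h3, ← h1] at h2
  have h4 : ((Module.finrank (ResidueField (B ⧸ P)) (CotangentSpace (B ⧸ P)) +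
      Module.finrank (ResidueField B) (cotangentSpan P) : ℕ) : WithBot ℕ∞) ≤
      ringKrullDim (B ⧸ P) + Module.finrank (ResidueField B) (cotangentSpan P) := by
    refine h2.trans ?_
    gcongr
  generalize ringKrullDim (B ⧸ P) = d at h4 ⊢
  induction d with
  | bot => simp at h4
  | coe d =>
    induction d with
    | top => exact le_top
    | coe d =>
      norm_cast at h4 ⊢
      omega

/-- A quotient of a regular local ring by elements whose classes in the cotangent space are
linearly independent is regular. -/
theorem quotient_span_range {n : ℕ} {v : Fin n → maximalIdeal B}
    (hv : LinearIndependent (ResidueField B) ((maximalIdeal B).toCotangent ∘ v)) :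
    IsRegularLocalRing (B ⧸ Ideal.span ((↑) '' Set.range v : Set B)) := by
  refine quotient_of_spanFinrank_le (span_image_le_maximalIdeal _) ?_
  rw [finrank_cotangentSpan_span_range hv]
  exact spanFinrank_span_range_le v

theorem exists_mem_maximalIdeal_notMem_minimalPrimes (hB : ¬ IsField B) :
    ∃ x ∈ maximalIdeal B, x ∉ maximalIdeal B ^ 2 ∧ ∀ p ∈ minimalPrimes B, x ∉ p := by
  have hfin : (minimalPrimes B).Finite := Ideal.finite_minimalPrimes_of_isNoetherianRing B ⊥
  have hdim := (iff_finrank_cotangentSpace B).1 inferInstance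
  rw [← finrank_cotangentSpace_eq_zero_iff] at hB
  have : ¬ (maximalIdeal B : Set B) ⊆
      ⋃ K ∈ (↑(insert (maximalIdeal B ^ 2) hfin.toFinset) : Set (Ideal B)), (K : Set B) := by
    -- Prime avoidance tolerates two non-prime ideals; m² fills both slots.
    refine (Ideal.subset_union_prime (f := id) (maximalIdeal B ^ 2)
      (maximalIdeal B ^ 2) ?_).not.mpr ?_
    · intro K hK hK' _
      rw [Finset.mem_insert, Set.Finite.mem_toFinset] at hK
      exact (hK.resolve_left hK').1.1
    · rintro ⟨K, hK, hle⟩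
      rw [Finset.mem_insert, Set.Finite.mem_toFinset] at hK
      obtain rfl | hK := hK
      · have h0 : Subsingleton (CotangentSpace B) := by
          rw [Ideal.cotangent_subsingleton_iff, IsIdempotentElem, ← sq]
          exact le_antisymm (Ideal.pow_le_self two_ne_zero) hle
        exact hB Module.finrank_zero_of_subsingleton
      · have hp := hK.1.1
        have h0 : K.height = 0 := Ideal.height_eq_zero_iff.2 hK
        rw [← (maximalIdeal.isMaximal B).eq_of_le hp.ne_top hle] at h0
        rw [← maximalIdeal_height_eq_ringKrullDim, h0] at hdim
        exact hB (by exact_mod_cast hdim)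
  obtain ⟨x, hx, hx'⟩ := Set.not_subset.1 this
  simp only [Set.mem_iUnion, not_exists, Finset.coe_insert, Set.Finite.coe_toFinset,
    Set.mem_insert_iff, forall_eq_or_imp, SetLike.mem_coe] at hx'
  exact ⟨x, hx, hx'⟩

/-- A minimal prime p inside (x) does not contain x, so ax ∈ p forces a ∈ p. Thus p ⊆ m p, and p = 0
by Nakayama. -/
theorem isDomain_of_isPrime_span_singleton {x : B} (hx : x ∈ maximalIdeal B)
    (hx' : ∀ p ∈ minimalPrimes B, x ∉ p) (h : (Ideal.span {x}).IsPrime) : IsDomain B := by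
  obtain ⟨p, hp, hpx⟩ :=
    Ideal.exists_minimalPrimes_le (I := (⊥ : Ideal B)) (bot_le : _ ≤ Ideal.span {x})
  have hpp : p.IsPrime := hp.1.1
  have hbot : p = ⊥ := by
    refine Submodule.eq_bot_of_le_smul_of_le_jacobson_bot (maximalIdeal B) p
      p.fg_of_isNoetherianRing ?_ (IsLocalRing.jacobson_eq_maximalIdeal _ bot_ne_top).ge
    intro y hy
    obtain ⟨a, rfl⟩ := Ideal.mem_span_singleton'.1 (hpx hy)
    rw [mul_comm]
    exact Ideal.mul_mem_mul hx ((hpp.mem_or_mem hy).resolve_right (hx' p hp))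
  rw [hbot] at hpp
  exact IsDomain.of_bot_isPrime B

theorem quotient_span_singleton {x : B} (hx : x ∈ maximalIdeal B) (hx' : x ∉ maximalIdeal B ^ 2) :
    ∃ _ : IsRegularLocalRing (B ⧸ Ideal.span {x}),
      Module.finrank (ResidueField (B ⧸ Ideal.span {x})) (CotangentSpace (B ⧸ Ideal.span {x})) + 1 =
        Module.finrank (ResidueField B) (CotangentSpace B) := by
  have hli : LinearIndependent (ResidueField B)
      ((maximalIdeal B).toCotangent ∘ (fun _ : Fin 1 => (⟨x, hx⟩ : maximalIdeal B))) := by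
    rw [linearIndependent_unique_iff]
    exact fun h => hx' (((maximalIdeal B).toCotangent_eq_zero _).1 h)
  have hreg := quotient_span_range hli
  have hcard := finrank_cotangentSpan_span_range hli
  rw [Set.range_const, Set.image_singleton] at hreg hcard
  refine ⟨hreg, ?_⟩
  rw [← finrank_cotangentSpace_quotient_add (J := Ideal.span {x}), hcard]

end

/-- Regular local rings are integral domains. -/
theorem isDomain (B : Type*) [CommRing B] [IsRegularLocalRing B] : IsDomain B := by
  obtain ⟨n, hn⟩ : ∃ n, Module.finrank (ResidueField B) (CotangentSpace B) = n := ⟨_, rfl⟩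
  induction n generalizing B with
  | zero => exact (finrank_cotangentSpace_eq_zero_iff.1 hn).isDomain
  | succ n ih =>
    have hB : ¬ IsField B := by
      rw [← finrank_cotangentSpace_eq_zero_iff]
      omega
    -- Since x ∉ m², B/(x) is regular of embedding dimension n, hence a domain by induction, so (x)
    -- is prime.
    obtain ⟨x, hx, hx2, hxp⟩ := exists_mem_maximalIdeal_notMem_minimalPrimes hB
    obtain ⟨hreg, hrank⟩ := quotient_span_singleton hx hx2
    exact isDomain_of_isPrime_span_singleton hx hxp
      ((Ideal.Quotient.isDomain_iff_prime _).1 (ih _ (Nat.succ_injective (hrank.trans hn))))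

/-! ### Regularity of a quotient in terms of height -/

section

variable {B : Type*} [CommRing B] [IsRegularLocalRing B]

theorem isPrime_span_range {n : ℕ} {v : Fin n → maximalIdeal B}
    (hv : LinearIndependent (ResidueField B) ((maximalIdeal B).toCotangent ∘ v)) :
    (Ideal.span ((↑) '' Set.range v : Set B)).IsPrime :=
  have := quotient_span_range hv
  (Ideal.Quotient.isDomain_iff_prime _).1 (isDomain _)

/-- Adjoining the generators one at a time gives a chain of primes, strict because each new class
lies outside the span of the earlier ones. -/
theorem le_height_span_range {n : ℕ} {v : Fin n → maximalIdeal B}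
    (hv : LinearIndependent (ResidueField B) ((maximalIdeal B).toCotangent ∘ v)) :
    (n : ℕ∞) ≤ (Ideal.span ((↑) '' Set.range v : Set B)).height := by
  induction n with
  | zero => simp
  | succ n ih =>
    obtain ⟨h1, h2⟩ := linearIndependent_finSucc'.1 hv
    change LinearIndependent _ ((maximalIdeal B).toCotangent ∘ Fin.init v) at h1
    change _ ∉ Submodule.span _ (Set.range ((maximalIdeal B).toCotangent ∘ Fin.init v)) at h2
    have := isPrime_span_range hv
    have := isPrime_span_range h1
    rw [Nat.cast_succ]
    refine (add_le_add_left (ih h1) 1).trans (Ideal.height_add_one_le_of_lt_of_isPrime ?_)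
    refine lt_of_le_of_ne (Ideal.span_mono (Set.image_mono ?_)) fun h => h2 ?_
    · rintro _ ⟨i, rfl⟩
      exact ⟨i.castSucc, rfl⟩
    · rw [Set.range_comp, ← cotangentSpan_span, h, cotangentSpan_span]
      exact Submodule.subset_span ⟨_, ⟨Fin.last n, rfl⟩, rfl⟩

/-- The quotient of a regular local ring by a proper ideal `J` is regular if and only if the image
of `J` in the cotangent space has dimension `height J`. -/
theorem quotient_iff_finrank_cotangentSpan_eq_height {J : Ideal B} (hJ : J ≠ ⊤) :
    IsRegularLocalRing (B ⧸ J) ↔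
      (Module.finrank (ResidueField B) (cotangentSpan J) : ℕ∞) = J.height := by
  obtain ⟨v, hvJ, hwl, hspan⟩ := exists_span_range_eq_cotangentSpan J
  have := isLocalRing_quotient hJ
  have hreg := quotient_span_range hwl
  have hprime := isPrime_span_range hwl
  have hdom := isDomain (B ⧸ Ideal.span ((↑) '' Set.range v : Set B))
  have hle := le_height_span_range hwl
  have hge := (Ideal.height_le_spanFinrank _ hprime.ne_top).trans
    (Nat.cast_le.2 (spanFinrank_span_range_le v))
  have hPJ : Ideal.span ((↑) '' Set.range v : Set B) ≤ J := by
    rw [Ideal.span_le]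
    rintro _ ⟨_, ⟨i, rfl⟩, rfl⟩
    exact hvJ i
  generalize Ideal.span ((↑) '' Set.range v : Set B) = P at *
  constructor
  · intro h
    suffices hJP : J = P by rw [hJP]; exact le_antisymm (hspan ▸ hle) (hspan ▸ hge)
    refine le_antisymm (fun x hx => ?_) hPJ
    by_contra hxP
    -- A nonzero element of J/P in the domain B/P would make dim B/J smaller than dim B/P, yet both
    -- equal the embedding dimension of B minus r.
    have h1 := ringKrullDim_succ_le_of_surjective (Ideal.Quotient.factor hPJ)
      (Ideal.Quotient.factor_surjective hPJ) (r := Ideal.Quotient.mk P x)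
      (mem_nonZeroDivisors_of_ne_zero (by rwa [Ne, Ideal.Quotient.eq_zero_iff_mem]))
      (by rw [Ideal.Quotient.factor_mk, Ideal.Quotient.eq_zero_iff_mem]; exact hx)
    rw [← (iff_finrank_cotangentSpace _).1 h, ← (iff_finrank_cotangentSpace _).1 hreg] at h1
    have h2 := finrank_cotangentSpace_quotient_add (J := P)
    have h3 := finrank_cotangentSpace_quotient_add (J := J)
    rw [hspan] at h2
    norm_cast at h1
    omega
  · intro h
    -- P ⊆ J ⊆ Q with P and Q primes of the same finite height, so all three coincide.
    obtain ⟨Q, hQ, hJQ, hQr⟩ := Ideal.exists_isPrime_height_eq h.symm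
    obtain rfl : P = Q := Ideal.eq_of_le_of_height_le P (hPJ.trans hJQ) (hQr.trans_le hle)
    rwa [le_antisymm hJQ hPJ]

end

end IsRegularLocalRing

/-! ### From cotangent space to differentials -/

namespace IsLocalRing

/-- The map `𝔪 / 𝔪² → k ⊗ Ω_{B/A}`, `[x] ↦ 1 ⊗ d x`, for a local `A`-algebra `B` with
residue field `k`. -/
noncomputable def cotangentSpaceToTensor (A B : Type*) [CommRing A] [CommRing B] [IsLocalRing B]
    [Algebra A B] : CotangentSpace B →ₗ[ResidueField B] ResidueField B ⊗[B] Ω[B⁄A] :=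
  (KaehlerDifferential.kerCotangentToTensor A B (ResidueField B) ∘ₗ
    (Ideal.Cotangent.equivOfEq _ _ ker_residue.symm).toLinearMap).extendScalarsOfSurjective
      residue_surjective

theorem cotangentSpaceToTensor_injective (A : Type*) {B : Type*} [CommRing A] [CommRing B]
    [IsLocalRing B] [Algebra A B]
    (g : ResidueField B →ₐ[A] B ⧸ RingHom.ker (algebraMap B (ResidueField B)) ^ 2)
    (hg : (IsScalarTower.toAlgHom A B (ResidueField B)).kerSquareLift.comp g = AlgHom.id A _) :
    Function.Injective (cotangentSpaceToTensor A B) := by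
  -- Algebra sections of B/m² → k correspond to linear retractions of the conormal map.
  obtain ⟨l, hl⟩ := (retractionKerCotangentToTensorEquivSection residue_surjective).symm ⟨g, hg⟩
  have h : Function.Injective (KaehlerDifferential.kerCotangentToTensor A B (ResidueField B)) :=
    Function.LeftInverse.injective (g := l) fun x => LinearMap.congr_fun hl x
  exact h.comp (LinearEquiv.injective _)

end IsLocalRing

/-! ### The Jacobian rank as the dimension of a cotangent image -/

namespace MixedJacobian

open IsLocalRing

universe u v

variable {A : Type u} [CommRing A] {S : Type v} [CommRing S] [Algebra A S]

theorem ResidueSplits.cotangentSpaceToTensor_injective {q : Ideal S} [q.IsPrime]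
    (h : ResidueSplits A q) :
    Function.Injective (cotangentSpaceToTensor A (Localization.AtPrime q)) := by
  obtain ⟨s, hs⟩ := h
  have h1 : q.map (algebraMap S (Localization.AtPrime q)) =
      maximalIdeal (Localization.AtPrime q) := Localization.AtPrime.map_eq_maximalIdeal
  have h2 : (q ^ 2).map (algebraMap S (Localization.AtPrime q)) =
      RingHom.ker (algebraMap (Localization.AtPrime q) q.ResidueField) ^ 2 := by
    rw [Ideal.map_pow, h1]
    exact congrArg (· ^ 2) ker_residue.symm
  let e : q.ResidueField →ₐ[A]
      Localization.AtPrime q ⧸ q.map (algebraMap S (Localization.AtPrime q)) :=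
    { toRingHom := Ideal.Quotient.factor h1.ge
      commutes' := fun _ => rfl }
  refine IsLocalRing.cotangentSpaceToTensor_injective A
    ((Ideal.Quotient.factorₐ A h2.le).comp (s.comp e)) ?_
  refine AlgHom.ext fun x => ?_
  obtain ⟨b, rfl⟩ := residue_surjective x
  have hs' := DFunLike.congr_fun hs (e (residue _ b))
  obtain ⟨c, hc⟩ := Ideal.Quotient.mk_surjective (s (e (residue _ b)))
  rw [AlgHom.comp_apply, ← hc] at hs'
  change Ideal.Quotient.mk _ c = Ideal.Quotient.mk _ b at hs'
  refine (congrArg (fun z => (IsScalarTower.toAlgHom A (Localization.AtPrime q)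
    q.ResidueField).kerSquareLift (Ideal.Quotient.factor h2.le z)) hc.symm).trans ?_
  change residue _ c = residue _ b
  rw [Ideal.Quotient.eq, h1] at hs'
  exact (Ideal.Quotient.eq).2 hs'

variable {I aS : Ideal S}

/-- The base change of the target of the Jacobian map to `k(q)` is `k(q) ⊗ Ω_{S_q/A}`. -/
theorem exists_equiv_tensor_jacobianTarget (q : Ideal S) [q.IsPrime] (h : I ⊔ aS ≤ q) :
    letI : Algebra (RBar I aS) q.ResidueField := (toResidueField q h).toAlgebra
    ∃ e : (q.ResidueField ⊗[RBar I aS] JacobianTarget I aS A) ≃ₗ[q.ResidueField]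
        (q.ResidueField ⊗[Localization.AtPrime q] Ω[Localization.AtPrime q⁄A]),
      ∀ f : S, e (1 ⊗ₜ (1 ⊗ₜ dBar aS A f)) =
        1 ⊗ₜ KaehlerDifferential.D A (Localization.AtPrime q) (algebraMap S _ f) := by
  let : Algebra (RBar I aS) q.ResidueField := (toResidueField q h).toAlgebra
  have : IsScalarTower S (RBar I aS) q.ResidueField := IsScalarTower.of_algebraMap_eq fun _ => rfl
  have : Algebra.FormallyEtale S (Localization.AtPrime q) := .of_isLocalization q.primeCompl
  -- Both sides reduce to k(q) ⊗_S Ω_{S/A}: `e1`, `e2`, `e3` cancel intermediate base changes, and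
  -- `e4` says that differentials localize.
  let e1 : JacobianTarget I aS A ≃ₗ[RBar I aS] RBar I aS ⊗[S] Ω[S⁄A] :=
    TensorProduct.AlgebraTensorModule.cancelBaseChange S (SBar aS) (RBar I aS) (RBar I aS) Ω[S⁄A]
  let e2 := TensorProduct.AlgebraTensorModule.cancelBaseChange S (RBar I aS) q.ResidueField
    q.ResidueField Ω[S⁄A]
  let e3 := TensorProduct.AlgebraTensorModule.cancelBaseChange S (Localization.AtPrime q)
    q.ResidueField q.ResidueField Ω[S⁄A]
  let e4 := KaehlerDifferential.tensorKaehlerEquivOfFormallyEtale A S (Localization.AtPrime q)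
  refine ⟨(e1.baseChange (RBar I aS) q.ResidueField).trans
    (e2.trans (e3.symm.trans (e4.baseChange (Localization.AtPrime q) q.ResidueField))),
    fun f => ?_⟩
  have h1 : e1 (1 ⊗ₜ dBar aS A f) = 1 ⊗ₜ KaehlerDifferential.D A S f :=
    (TensorProduct.AlgebraTensorModule.cancelBaseChange_tmul ..).trans (by rw [one_smul]; rfl)
  have h3 : e3.symm (1 ⊗ₜ KaehlerDifferential.D A S f) =
      1 ⊗ₜ (1 ⊗ₜ KaehlerDifferential.D A S f) := by
    rw [LinearEquiv.symm_apply_eq]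
    exact ((TensorProduct.AlgebraTensorModule.cancelBaseChange_tmul ..).trans
      (by rw [one_smul])).symm
  have h2 : e2 (1 ⊗ₜ (1 ⊗ₜ KaehlerDifferential.D A S f)) = 1 ⊗ₜ KaehlerDifferential.D A S f :=
    (TensorProduct.AlgebraTensorModule.cancelBaseChange_tmul ..).trans (by rw [one_smul])
  have h4 : e4 (1 ⊗ₜ KaehlerDifferential.D A S f) =
      KaehlerDifferential.D A (Localization.AtPrime q) (algebraMap S _ f) := by
    rw [← LinearEquiv.eq_symm_apply]
    exact (KaehlerDifferential.tensorKaehlerEquivOfFormallyEtale_symm_D_algebraMap ..).symm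
  rw [LinearEquiv.trans_apply, LinearEquiv.trans_apply, LinearEquiv.trans_apply,
    LinearEquiv.baseChange_tmul, h1, h2, h3, LinearEquiv.baseChange_tmul, h4]

theorem range_baseChange_eq_span {R M N K : Type*} [CommRing R] [AddCommGroup M] [AddCommGroup N]
    [Module R M] [Module R N] [CommRing K] [Algebra R K] (f : M →ₗ[R] N) :
    LinearMap.range (f.baseChange K) = Submodule.span K (Set.range fun x => (1 : K) ⊗ₜ[R] f x) := by
  rw [LinearMap.range_eq_map, ← Submodule.baseChange_top, Submodule.baseChange_eq_span,
    Submodule.map_span, Submodule.map_top, LinearMap.coe_range, ← Set.range_comp]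
  rfl

theorem cotangentSpan_map_algebraMap (q : Ideal S) [q.IsPrime] (hI : I ≤ q) :
    cotangentSpan (I.map (algebraMap S (Localization.AtPrime q))) =
      Submodule.span q.ResidueField (Set.range fun f : I =>
        (maximalIdeal (Localization.AtPrime q)).toCotangent ⟨algebraMap S _ f,
          (IsLocalization.AtPrime.to_map_mem_maximal_iff _ q (f : S)).2 (hI f.2)⟩) := by
  rw [← Function.comp_def (maximalIdeal (Localization.AtPrime q)).toCotangent, Set.range_comp,
    ← cotangentSpan_span, ← Set.range_comp, Ideal.map, Set.image_eq_range]
  rfl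

theorem jacobianRank_eq {q : Ideal S} [q.IsPrime] (h : I ⊔ aS ≤ q) (hs : ResidueSplits A q) :
    jacobianRank A q h = Module.rank q.ResidueField
      (cotangentSpan (I.map (algebraMap S (Localization.AtPrime q)))) := by
  obtain ⟨e, he⟩ := exists_equiv_tensor_jacobianTarget (A := A) q h
  let : Algebra (RBar I aS) q.ResidueField := (toResidueField q h).toAlgebra
  suffices hmap : (LinearMap.range ((jacobianMap I aS A).baseChange q.ResidueField)).map
      e.toLinearMap = (cotangentSpan (I.map (algebraMap S (Localization.AtPrime q)))).map
        (cotangentSpaceToTensor A (Localization.AtPrime q)) from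
    (e.submoduleMap (LinearMap.range ((jacobianMap I aS A).baseChange _))).rank_eq.trans
      ((LinearEquiv.ofEq _ _ hmap).rank_eq.trans
        (Submodule.equivMapOfInjective _ hs.cotangentSpaceToTensor_injective _).rank_eq.symm)
  rw [range_baseChange_eq_span, cotangentSpan_map_algebraMap q (le_sup_left.trans h),
    Submodule.map_span, Submodule.map_span, ← Set.range_comp, ← Set.range_comp]
  congr 1
  rw [← (Submodule.Quotient.mk_surjective (conormalRel I aS)).range_comp]
  exact congrArg Set.range (funext fun f => he f)

end MixedJacobian

/-! ### The Jacobian criterion -/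

theorem IsRegularLocalRing.congr {R R' : Type*} [CommRing R] [CommRing R'] (e : R ≃+* R') :
    IsRegularLocalRing R ↔ IsRegularLocalRing R' :=
  ⟨fun _ => .of_ringEquiv e, fun _ => .of_ringEquiv e.symm⟩

theorem mainTheorem4 {A : Type*} [CommRing A] {V : Type*} [CommRing V] [Algebra A V] (n : ℕ)
    (aS : Ideal (MvPolynomial (Fin n) V)) (hS : MixedJacobian.IsSetup A aS)
    (I q : Ideal (MvPolynomial (Fin n) V)) [q.IsPrime] (hq : I ⊔ aS ≤ q) :
    IsRegularLocalRing
        (Localization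
          (Algebra.algebraMapSubmonoid (MvPolynomial (Fin n) V ⧸ I) q.primeCompl)) ↔
      MixedJacobian.jacobianRank A q hq =
        ((I.map (algebraMap (MvPolynomial (Fin n) V) (Localization.AtPrime q))).height :
          Cardinal) := by
  obtain ⟨hreg, hsplit⟩ := hS q (le_sup_right.trans hq)
  have hI : I.map (algebraMap (MvPolynomial (Fin n) V) (Localization.AtPrime q)) ≠ ⊤ := by
    refine IsLocalRing.ne_top_of_le_maximalIdeal ?_
    rw [← Localization.AtPrime.map_eq_maximalIdeal]
    exact Ideal.map_mono (le_sup_left.trans hq)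
  -- Localization commutes with the quotient by I. The dimension is finite, so the equality of
  -- cardinals is one in `ℕ∞`.
  rw [IsRegularLocalRing.congr (R' := Localization.AtPrime q ⧸
      I.map (algebraMap (MvPolynomial (Fin n) V) (Localization.AtPrime q))) (IsLocalization.algEquiv
      (Algebra.algebraMapSubmonoid (MvPolynomial (Fin n) V ⧸ I) q.primeCompl)
      (Localization (Algebra.algebraMapSubmonoid (MvPolynomial (Fin n) V ⧸ I) q.primeCompl))
      (Localization.AtPrime q ⧸
        I.map (algebraMap (MvPolynomial (Fin n) V) (Localization.AtPrime q)))).toRingEquiv,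
    IsRegularLocalRing.quotient_iff_finrank_cotangentSpan_eq_height hI,
    MixedJacobian.jacobianRank_eq hq hsplit, ← Module.finrank_eq_rank, ← Cardinal.ofENat_nat,
    Cardinal.ofENat_inj]
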